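/- Let $\mathfrak g$ be a finite-dimensional complex semisimple Lie algebra, $\mathfrak h$ a Cartan subalgebra, $\Delta^+$ a system of positive roots with simple roots $\Pi$, $\mathfrak n^{op}$ the sum of the negative root spaces, and $W$ the Weyl group. Fix a Chevalley basis $\{X_\alpha, Y_\alpha \mid \alpha\in\Delta^+\}\cup\{H_\alpha \mid \alpha\in\Pi\}$ of $\mathfrak g$, where $Y_\alpha = X_{-\alpha}$ for $\alpha\in\Delta^+$; let $\sigma$ be the involutive anti-automorphism of $\mathfrak g$ with $\sigma(H)=H$ for $H\in\mathfrak h$ and $\sigma(X_\alpha)=Y_\alpha$ for $\alpha\in\Delta^+$, extended to an anti-automorphism of $U(\mathfrak g)$, and let $U(\mathfrak n^{op})_{\mathbb Z}\subset U(\mathfrak n^{op})$ be the subring generated by the $Y_\alpha^n/n!$, $\alpha\in\Delta^+$, $n\ge 0$. For an integral weight $\nu\in\mathfrak h^*$ let $F(\nu)$ be the irreducible finite-dimensional $\mathfrak g$-module of extremal weight $\nu$, that is, the one whose highest weight is the dominant weight in the orbit $W\nu$. Let $v_0$ be a highest weight vector of $F(\nu)$ and let $(\cdot,\cdot)$ be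 the contravariant form on $F(\nu)$ with $(v_0,v_0)=1$, i.e. the symmetric bilinear form with $(xu,v)=(u,\sigma(x)v)$ for all $x\in U(\mathfrak g)$ and $u,v\in F(\nu)$. For a weight $\mu$ of $F(\nu)$ let $D_{F(\nu)}(\mu)$ be the determinant of the Gram matrix $\big((e_i,e_j)\big)_{i,j}$, where $(e_j)$ is a $\mathbb Z$-basis of the $\mu$-weight space of the lattice $U(\mathfrak n^{op})_{\mathbb Z}v_0$. Then for every integral weight $\nu$ and every $w\in W$, the weight space of $F(\nu)$ of weight $w\nu$ is one-dimensional, the $w\nu$-weight space of $U(\mathfrak n^{op})_{\mathbb Z}v_0$ is a free $\mathbb Z$-module of rank one, and the number $D_{F(\nu)}(w\nu)$ (which does not depend on the $\mathbb Z$-basis chosen) is real and positive: $$\operatorname{sgn}\big(D_{F(\nu)}(w\nu)\big)=1 .$$ -/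

import Mathlib

namespace SignedKL

open LieAlgebra LieAlgebra.IsKilling

noncomputable section

variable {L : Type*} [LieRing L] [LieAlgebra ℂ L] [FiniteDimensional ℂ L] [IsSemisimple ℂ L]
  {H : LieSubalgebra ℂ L} [H.IsCartanSubalgebra]

/-- The root `-α`. -/
def negRoot (α : H.root) : H.root :=
  ⟨-(α : LieModule.Weight ℂ H L), by
    simpa using LieModule.Weight.IsNonZero.neg (LieSubalgebra.isNonZero_coe_root α)⟩

@[simp] lemma coe_negRoot (α : H.root) :
    ((negRoot α : H.root) : LieModule.Weight ℂ H L) = -(α : LieModule.Weight ℂ H L) := rfl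

variable (H) in
/-- The root vectors of a Chevalley basis of the complex semisimple Lie algebra `L` relative to the
Cartan subalgebra `H`: a choice of `X α` in every root space with `[X α, X (-α)] = H_α` (the
coroot) and `[X α, X β] = ±(p + 1) X (α + β)` whenever `α`, `β`, `α + β` are roots, where `p` is
the largest integer such that `β - p α` is a root. Together with the coroots of the simple roots,
the `X α` form a Chevalley basis of `L`; for `α` positive, `Y α` is `X (-α)`. -/
structure ChevalleyBasis where
  /-- The root vector of the root `α`. -/
  X : H.root → L
  X_mem (α : H.root) : X α ∈ rootSpace H (α : LieModule.Weight ℂ H L)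
  lie_X_neg (α : H.root) :
    ⁅X α, X (negRoot α)⁆ = ((coroot (α : LieModule.Weight ℂ H L) : H) : L)
  lie_X_X (α β γ : H.root)
    (hγ : (rootSystem H).root γ = (rootSystem H).root α + (rootSystem H).root β) :
    ⁅X α, X β⁆ =
        ((LieModule.chainBotCoeff (α : LieModule.Weight ℂ H L)
          (β : LieModule.Weight ℂ H L) : ℂ) + 1) • X γ ∨
    ⁅X α, X β⁆ =
      -(((LieModule.chainBotCoeff (α : LieModule.Weight ℂ H L)
          (β : LieModule.Weight ℂ H L) : ℂ) + 1) • X γ)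

namespace ChevalleyBasis

variable (C : ChevalleyBasis H)

/-- `Y α`, for a positive root `α`. -/
def Y (α : H.root) : L := C.X (negRoot α)

/-- The linear map `σ : L → L` that is the identity on `H` and exchanges `X α` and `X (-α)` for
every root `α` (see `sigma_coe` and `sigma_X`). It is the involutive anti-automorphism of `L`
attached to the Chevalley basis. The coefficient of `X α` in `x` is
`κ(x, X (-α)) / κ(X α, X (-α))`, with `κ` the Killing form. -/
def sigma : L →ₗ[ℂ] L :=
  LinearMap.id + ∑ α : H.root,
    ((killingForm ℂ L (C.X α) (C.X (negRoot α)))⁻¹ •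
      (killingForm ℂ L (C.X (negRoot α)))).smulRight (C.X (negRoot α) - C.X α)

lemma killingForm_X_coe (α : H.root) (h : H) : killingForm ℂ L (C.X α) (h : L) = 0 := by
  refine killingForm_apply_eq_zero_of_mem_rootSpace_of_add_ne_zero ℂ L H (C.X_mem α)
    (β := 0) ?_ ?_
  · simp
  · simp [LieSubalgebra.isNonZero_coe_root α]

lemma killingForm_X_X (α β : H.root) (hβ : β ≠ negRoot α) :
    killingForm ℂ L (C.X α) (C.X β) = 0 := by
  refine killingForm_apply_eq_zero_of_mem_rootSpace_of_add_ne_zero ℂ L H (C.X_mem α)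
    (C.X_mem β) fun h => hβ ?_
  apply Subtype.ext
  apply DFunLike.ext'
  rw [coe_negRoot, LieModule.Weight.coe_neg]
  exact (neg_eq_of_add_eq_zero_right h).symm

lemma negRoot_negRoot (α : H.root) : negRoot (negRoot α) = α := by
  apply Subtype.ext
  simp

lemma killingForm_X_negRoot (α : H.root) :
    killingForm ℂ L (C.X α) (C.X (negRoot α)) ≠ 0 := by
  intro h0
  have h1 := lie_eq_killingForm_smul_of_mem_rootSpace_of_mem_rootSpace_neg
    (C.X_mem α) (C.X_mem (negRoot α))
  rw [h0, zero_smul, C.lie_X_neg α] at h1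
  have h2 : coroot (α : LieModule.Weight ℂ H L) = 0 := Subtype.ext h1
  exact LieSubalgebra.isNonZero_coe_root α (coroot_eq_zero_iff.mp h2)

lemma sigma_coe (h : H) : C.sigma (h : L) = h := by
  simp [sigma, killingForm_X_coe]

lemma sigma_X (α : H.root) : C.sigma (C.X α) = C.X (negRoot α) := by
  classical
  have key : ∀ β : H.root, β ≠ α → killingForm ℂ L (C.X (negRoot β)) (C.X α) = 0 := by
    intro β hβ
    refine C.killingForm_X_X _ _ ?_
    rw [negRoot_negRoot]
    exact hβ.symm
  simp only [sigma, LinearMap.add_apply, LinearMap.id_apply, LinearMap.sum_apply,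
    LinearMap.smulRight_apply, LinearMap.smul_apply]
  rw [Finset.sum_eq_single α]
  · rw [LieModule.traceForm_comm ℂ L L (C.X (negRoot α)) (C.X α), smul_eq_mul,
      inv_mul_cancel₀ (C.killingForm_X_negRoot α)]
    simp
  · intro β _ hβ
    rw [key β hβ]
    simp
  · simp

/-- The subring `U(𝔫ᵒᵖ)_ℤ` of the universal enveloping algebra of `L` generated by the divided
powers `Y α ^ n / n!`, for `α` a positive root and `n ≥ 0`. -/
def kostantNegative (b : (rootSystem H).Base) : Subalgebra ℤ (UniversalEnvelopingAlgebra ℂ L) :=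
  Algebra.adjoin ℤ {u | ∃ (α : H.root) (n : ℕ), b.IsPos α ∧
    u = (n.factorial : ℂ)⁻¹ • (UniversalEnvelopingAlgebra.ι ℂ (C.Y α)) ^ n}

end ChevalleyBasis

/-- The weight `ν` is integral: it takes integral values on all coroots. -/
def IsIntegralWeight (ν : Module.Dual ℂ H) : Prop :=
  ∀ α : H.root, ∃ n : ℤ, ν ((rootSystem H).coroot α) = n

variable {F : Type*} [AddCommGroup F] [Module ℂ F] [LieRingModule L F] [LieModule ℂ L F]

/-- `v` is a highest weight vector of weight `μ`, relative to the positive roots given by `b`. -/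
structure IsHighestWeightVector (b : (rootSystem H).Base) (μ : Module.Dual ℂ H) (v : F) :
    Prop where
  ne_zero : v ≠ 0
  mem_weightSpace : v ∈ LieModule.weightSpace F (μ : H → ℂ)
  lie_eq_zero (α : H.root) (hα : b.IsPos α) (x : L)
    (hx : x ∈ rootSpace H (α : LieModule.Weight ℂ H L)) : ⁅x, v⁆ = 0

/-- A contravariant form on an `L`-module: a symmetric bilinear form with
`(x u, v) = (u, σ(x) v)`. (If this holds for all `x` in `L`, it holds for all `x` in the enveloping
algebra, with `σ` extended to an anti-automorphism of the enveloping algebra.) -/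
structure IsContravariant (C : ChevalleyBasis H) (B : LinearMap.BilinForm ℂ F) : Prop where
  isSymm (u v : F) : B u v = B v u
  lie_left (x : L) (u v : F) : B ⁅x, u⁆ v = B u ⁅C.sigma x, v⁆

/-- The subgroup `U(𝔫ᵒᵖ)_ℤ v` of `F`. -/
def integralForm (C : ChevalleyBasis H) (b : (rootSystem H).Base) (v : F) : Submodule ℤ F :=
  (Subalgebra.toSubmodule (C.kostantNegative b)).map
    ((LinearMap.applyₗ v ∘ₗ (UniversalEnvelopingAlgebra.lift ℂ
      (LieModule.toEnd ℂ L F)).toLinearMap).restrictScalars ℤ)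

lemma mem_integralForm (C : ChevalleyBasis H) (b : (rootSystem H).Base) (v x : F) :
    x ∈ integralForm C b v ↔ ∃ u ∈ C.kostantNegative b,
      UniversalEnvelopingAlgebra.lift ℂ (LieModule.toEnd ℂ L F) u v = x := by
  rfl

/-- The weight space of weight `μ` of the lattice `U(𝔫ᵒᵖ)_ℤ v`. -/
def integralWeightSpace (C : ChevalleyBasis H) (b : (rootSystem H).Base) (v : F)
    (μ : Module.Dual ℂ H) : Submodule ℤ F :=
  integralForm C b v ⊓
    (LieModule.weightSpace F (μ : H → ℂ)).toSubmodule.restrictScalars ℤ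

end

end SignedKL

namespace SignedKL

open LieAlgebra LieAlgebra.IsKilling

noncomputable section

set_option linter.unusedSectionVars false

/-! ### Heights and the `sl₂`-triples of the root vectors. -/

section

variable {L : Type*} [LieRing L] [LieAlgebra ℂ L] [FiniteDimensional ℂ L] [IsSemisimple ℂ L]
  {H : LieSubalgebra ℂ L} [H.IsCartanSubalgebra]

/-! The determinant is the square length of a generator of a rank-one lattice. It therefore suffices
to find a vector `u` of positive square length spanning the weight space of `w • ν`, and to see that
the generator is a real multiple of `u`.

The vector comes from `sl₂`-theory. If `u` has weight `χ` with `χ(α^∨) = n ≥ 0` and `X α` kills `u`,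
then with `e = X α`, `f = X (-α)` the vector `fⁿ u` has weight `s_α χ`, and contravariance gives
`(fⁿ u, fⁿ u) = (u, eⁿ fⁿ u) = c (u, u)` with `c` a positive integer. Starting from `v₀`, positivity
propagates along the Weyl orbit. The induction hypothesis is `IsExtremalWeight`; it speaks of all
roots, so arbitrary products of reflections are allowed and no reduced expression is needed
(`IsExtremalWeight.sub_smul`).

Reality needs an argument because the square of a complex multiple could have any argument. The
rational span of the monomials in the `Y α` applied to `v₀` is stable under all root vectors, the
form is rational on it, and it contains both the lattice and `u`. So if `x = c u` lies in the
lattice, `c = (x, u) / (u, u)` is rational. The lattice part of the line is finitely generated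
(heights bound the nonzero monomials) and nonzero (clear denominators), hence generated by some `q
u` with `q` rational, and the determinant is `q² (u, u) > 0`. -/

lemma root_negRoot (α : H.root) :
    (rootSystem H).root (negRoot α) = -(rootSystem H).root α := by
  simp

lemma coroot_negRoot (α : H.root) :
    (rootSystem H).coroot (negRoot α) = -(rootSystem H).coroot α := by
  simp

lemma root_coroot_self (α : H.root) :
    (rootSystem H).root α ((rootSystem H).coroot α) = 2 :=
  (rootSystem H).root_coroot_two α

lemma exists_int_root_coroot (α β : H.root) :
    ∃ n : ℤ, (rootSystem H).root α ((rootSystem H).coroot β) = n := by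
  obtain ⟨n, hn⟩ := RootPairing.IsValuedIn.exists_value (S := ℤ) (P := rootSystem H) α β
  exact ⟨n, by simpa using hn.symm⟩

lemma height_negRoot (b : (rootSystem H).Base) (α : H.root) :
    b.height (negRoot α) = -b.height α := by
  obtain ⟨f, -, -, hf⟩ := b.exists_root_eq_sum_int α
  have h : (rootSystem H).root (negRoot α) =
      ∑ j ∈ b.support, (-f) j • (rootSystem H).root j := by
    rw [root_negRoot, hf]
    simp
  simp only [RootPairing.Base.height_eq_sum hf, RootPairing.Base.height_eq_sum h, Pi.neg_apply,
    Finset.sum_neg_distrib]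

lemma isPos_or_isPos_negRoot (b : (rootSystem H).Base) (α : H.root) :
    b.IsPos α ∨ b.IsPos (negRoot α) := by
  rw [RootPairing.Base.isPos_iff, RootPairing.Base.isPos_iff, height_negRoot]
  have := b.height_ne_zero α
  lia

/-- There is an element of the Cartan subalgebra on which every root takes its height as value. -/
lemma exists_root_apply_eq_height (b : (rootSystem H).Base) :
    ∃ ρ : H, ∀ α : H.root, (rootSystem H).root α ρ = b.height α := by
  classical
  set f : Module.Dual ℂ (Module.Dual ℂ H) := b.toWeightBasis.constr ℂ fun _ => (1 : ℂ)
  have hf (j : H.root) (hj : j ∈ b.support) : f ((rootSystem H).root j) = 1 := by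
    have := b.toWeightBasis.constr_basis ℂ (fun _ => (1 : ℂ)) ⟨j, hj⟩
    rwa [RootPairing.Base.toWeightBasis_apply] at this
  refine ⟨(Module.evalEquiv ℂ H).symm f, fun α => ?_⟩
  rw [Module.apply_evalEquiv_symm_apply]
  obtain ⟨c, -, -, hc⟩ := b.exists_root_eq_sum_int α
  rw [RootPairing.Base.height_eq_sum hc, hc, map_sum, Int.cast_sum]
  refine Finset.sum_congr rfl fun j hj => ?_
  rw [map_zsmul, hf j hj]
  simp

namespace ChevalleyBasis

variable (C : ChevalleyBasis H)

lemma isSl2Triple (α : H.root) :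
    IsSl2Triple (((rootSystem H).coroot α : H) : L) (C.X α) (C.X (negRoot α)) where
  h_ne_zero h := (rootSystem H).ne_zero' α (Subtype.ext h)
  lie_e_f := C.lie_X_neg α
  lie_h_e_nsmul := by
    have h := lie_eq_smul_of_mem_rootSpace (C.X_mem α) ((rootSystem H).coroot α)
    rw [LieSubalgebra.coe_bracket_of_module] at h
    rw [h, ← Nat.cast_smul_eq_nsmul ℂ]
    congr 1
    simpa using root_coroot_self α
  lie_h_f_nsmul := by
    have h := lie_eq_smul_of_mem_rootSpace (C.X_mem (negRoot α)) ((rootSystem H).coroot α)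
    rw [LieSubalgebra.coe_bracket_of_module] at h
    rw [h, ← Nat.cast_smul_eq_nsmul ℂ, ← neg_smul]
    congr 1
    simpa using root_coroot_self α

/-- Only the rationality of the structure constants is retained from the Chevalley relations; this
is all that stability of the rational form requires. -/
lemma lie_X_X_cases (α β : H.root) :
    β = negRoot α ∨ (∃ (γ : H.root) (q : ℚ), ⁅C.X α, C.X β⁆ = (q : ℂ) • C.X γ) ∨
      ⁅C.X α, C.X β⁆ = 0 := by
  by_cases h0 : (rootSystem H).root α + (rootSystem H).root β = 0
  · left
    apply (rootSystem H).root.injective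
    rw [root_negRoot]
    exact (neg_eq_of_add_eq_zero_right h0).symm
  right
  have hmem := lie_mem_genWeightSpace_of_mem_genWeightSpace (C.X_mem α) (C.X_mem β)
  by_cases hb : rootSpace H ((α : LieModule.Weight ℂ H L) + (β : LieModule.Weight ℂ H L) : H → ℂ) = ⊥
  · right
    have : ⁅C.X α, C.X β⁆ ∈ rootSpace H
        ((α : LieModule.Weight ℂ H L) + (β : LieModule.Weight ℂ H L) : H → ℂ) := hmem
    rw [hb] at this
    simpa using this
  left
  let γ : LieModule.Weight ℂ H L := ⟨_, hb⟩
  have hγ : γ.IsNonZero := by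
    intro h
    apply h0
    ext x
    exact congrFun h x
  refine ⟨⟨γ, by simpa using hγ⟩, ?_⟩
  rcases C.lie_X_X α β ⟨γ, by simpa using hγ⟩ (by ext x; simp [γ]) with h | h
  · exact ⟨(LieModule.chainBotCoeff (α : LieModule.Weight ℂ H L)
          (β : LieModule.Weight ℂ H L) : ℚ) + 1, by rw [h]; push_cast; rfl⟩
  · exact ⟨-((LieModule.chainBotCoeff (α : LieModule.Weight ℂ H L)
          (β : LieModule.Weight ℂ H L) : ℚ) + 1), by rw [h]; push_cast; rw [neg_smul]⟩

lemma X_ne_zero (α : H.root) : C.X α ≠ 0 := (C.isSl2Triple α).e_ne_zero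

/-- The Cartan subalgebra and the root vectors span the Lie algebra. -/
lemma mem_of_forall_X_mem (p : Submodule ℂ L) (hH : ∀ h : H, (h : L) ∈ p)
    (hX : ∀ α, C.X α ∈ p) (x : L) : x ∈ p := by
  have htop := LieModule.iSup_genWeightSpace_eq_top' ℂ H L
  have key : (⨆ χ : LieModule.Weight ℂ H L, (rootSpace H χ).toSubmodule) ≤ p := by
    refine iSup_le fun χ => ?_
    by_cases hχ : χ.IsZero
    · rw [hχ.eq]
      intro y hy
      have hy' : y ∈ (rootSpace H (0 : H → ℂ)) := hy
      rw [rootSpace_zero_eq, LieSubalgebra.mem_toLieSubmodule] at hy'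
      exact hH ⟨y, hy'⟩
    · intro y hy
      let α : H.root := ⟨χ, by simpa using hχ⟩
      have h1 := finrank_rootSpace_eq_one χ hχ
      obtain ⟨c, hc⟩ := (finrank_eq_one_iff_of_nonzero' (⟨C.X α, C.X_mem α⟩ : rootSpace H χ)
        (fun h => C.X_ne_zero α (congrArg Subtype.val h))).mp h1 ⟨y, hy⟩
      have : c • C.X α = y := congrArg Subtype.val hc
      rw [← this]
      exact p.smul_mem c (hX α)
  have hx : x ∈ (⊤ : LieSubmodule ℂ H L).toSubmodule := Submodule.mem_top
  rw [← htop, LieSubmodule.iSup_toSubmodule] at hx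
  exact key hx

end ChevalleyBasis

/-! ### Weights and root strings in finite-dimensional modules. -/

variable {F : Type*} [AddCommGroup F] [Module ℂ F] [LieRingModule L F] [LieModule ℂ L F]

lemma mem_weightSpace_iff (χ : Module.Dual ℂ H) (u : F) :
    u ∈ LieModule.weightSpace F (χ : H → ℂ) ↔ ∀ h : H, ⁅(h : L), u⁆ = χ h • u := by
  rw [LieModule.mem_weightSpace]
  rfl

lemma weightSpace_ne_bot_iff (χ : Module.Dual ℂ H) :
    LieModule.weightSpace F (χ : H → ℂ) ≠ ⊥ ↔
      ∃ u ∈ LieModule.weightSpace F (χ : H → ℂ), u ≠ 0 := by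
  simp [LieSubmodule.eq_bot_iff]

lemma X_lie_mem_weightSpace (C : ChevalleyBasis H) (α : H.root) {χ χ' : Module.Dual ℂ H} {u : F}
    (hu : u ∈ LieModule.weightSpace F (χ : H → ℂ)) (h : χ + (rootSystem H).root α = χ') :
    ⁅C.X α, u⁆ ∈ LieModule.weightSpace F (χ' : H → ℂ) := by
  rw [mem_weightSpace_iff] at hu ⊢
  intro x
  have h1 := lie_eq_smul_of_mem_rootSpace (C.X_mem α) x
  rw [LieSubalgebra.coe_bracket_of_module] at h1
  rw [leibniz_lie, h1, hu x, smul_lie, lie_smul, ← add_smul, ← h]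
  congr 1
  simp [add_comm]

lemma X_pow_mem_weightSpace (C : ChevalleyBasis H) (α : H.root) {χ χ' : Module.Dual ℂ H} {u : F}
    (n : ℕ) (hu : u ∈ LieModule.weightSpace F (χ : H → ℂ))
    (h : χ + (n : ℂ) • (rootSystem H).root α = χ') :
    (LieModule.toEnd ℂ L F (C.X α) ^ n) u ∈ LieModule.weightSpace F (χ' : H → ℂ) := by
  induction n generalizing χ' with
  | zero =>
    have : χ = χ' := by simpa using h
    simpa [← this] using hu
  | succ n ih =>
    rw [pow_succ', Module.End.mul_apply, LieModule.toEnd_apply_apply]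
    refine X_lie_mem_weightSpace C α (ih rfl) ?_
    rw [← h]
    push_cast
    module

/-- A vector `u` killed by `e` with `h`-eigenvalue `n` satisfies `eᵏ fᵏ u = c u` with `c` a
positive integer, for `k ≤ n`. -/
lemma exists_pow_toEnd_pow_toEnd {h e f : L} {t : IsSl2Triple h e f} {u : F} {n : ℕ}
    (P : t.HasPrimitiveVectorWith u (n : ℂ)) (k : ℕ) (hk : k ≤ n) :
    ∃ c : ℕ, 0 < c ∧ (LieModule.toEnd ℂ L F e ^ k) ((LieModule.toEnd ℂ L F f ^ k) u) =
      (c : ℂ) • u := by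
  induction k with
  | zero => exact ⟨1, one_pos, by simp⟩
  | succ k ih =>
    obtain ⟨c, hc, hcu⟩ := ih (by omega)
    -- The new factor comes from `e fᵏ⁺¹ u = (k + 1)(n - k) fᵏ u`; it is positive because `k < n`.
    refine ⟨(k + 1) * (n - k) * c, by have : 0 < n - k := by omega
                                      positivity, ?_⟩
    rw [pow_succ, Module.End.mul_apply, LieModule.toEnd_apply_apply, P.lie_e_pow_succ_toEnd_f,
      map_smul, hcu, smul_smul]
    push_cast [Nat.cast_sub (show k ≤ n by omega)]
    rfl

/-- Otherwise the `eᵏ u` would be eigenvectors of `h` for the infinitely many distinct eigenvalues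
`z + 2k`. -/
lemma exists_pow_toEnd_eq_zero [FiniteDimensional ℂ F] {h e f : L} (t : IsSl2Triple h e f)
    {u : F} {z : ℂ} (hu : ⁅h, u⁆ = z • u) : ∃ k, (LieModule.toEnd ℂ L F e ^ k) u = 0 := by
  by_contra! contra
  have hinj : Function.Injective fun n : ℕ => z + 2 * (n : ℂ) := fun a b hab => by
    simpa using hab
  have aux (χ : Set.range fun n : ℕ => z + 2 * (n : ℂ)) :
      (LieModule.toEnd ℂ L F h).HasEigenvector χ
        ((LieModule.toEnd ℂ L F e ^ χ.property.choose) u) := by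
    refine ⟨?_, contra _⟩
    rw [Module.End.mem_eigenspace_iff, LieModule.toEnd_apply_apply, t.lie_h_pow_toEnd_e hu]
    congr 1
    exact χ.property.choose_spec
  have := ((LieModule.toEnd ℂ L F h).eigenvectors_linearIndependent _ _ aux).finite
  exact (Set.infinite_range_of_injective hinj) (Set.toFinite _)

/-- Climb the `α`-string to its top `eᵏ u`, where the eigenvalue of `h` is a natural number `m`,
then descend `m - k` steps, which stays within the nonzero part of the string and ends at `χ - (m -
2k) α = s_α χ`. The sign is imposed on a real part since integrality of `χ(α^∨)` only emerges during
the proof. -/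
lemma weightSpace_reflection_ne_bot_of_re_nonneg [FiniteDimensional ℂ F] (C : ChevalleyBasis H)
    (α : H.root) {χ : Module.Dual ℂ H} (hχ : 0 ≤ (χ ((rootSystem H).coroot α)).re)
    (h : LieModule.weightSpace F (χ : H → ℂ) ≠ ⊥) :
    LieModule.weightSpace F
      ((χ - χ ((rootSystem H).coroot α) • (rootSystem H).root α : Module.Dual ℂ H) : H → ℂ) ≠ ⊥ := by
  obtain ⟨u, hu, hu0⟩ := (weightSpace_ne_bot_iff χ).mp h
  have t := C.isSl2Triple α
  have hh := (mem_weightSpace_iff χ u).mp hu ((rootSystem H).coroot α)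
  obtain ⟨k, hk, hk'⟩ := Nat.exists_not_and_succ_of_not_zero_of_exists
    (p := fun k => (LieModule.toEnd ℂ L F (C.X α) ^ k) u = 0) (by simpa using hu0)
    (exists_pow_toEnd_eq_zero t hh)
  have P : t.HasPrimitiveVectorWith ((LieModule.toEnd ℂ L F (C.X α) ^ k) u)
      (χ ((rootSystem H).coroot α) + 2 * k) :=
    ⟨hk, t.lie_h_pow_toEnd_e hh k, by rw [IsSl2Triple.lie_e_pow_toEnd_e, hk']⟩
  obtain ⟨m, hm⟩ := P.exists_nat
  have hz : χ ((rootSystem H).coroot α) = m - 2 * k := by linear_combination hm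
  have hmk : 2 * k ≤ m := by
    rw [hz] at hχ
    have h1 : (0 : ℝ) ≤ (m : ℝ) - 2 * k := by simpa using hχ
    have h2 : (2 * k : ℝ) ≤ m := by linarith
    exact_mod_cast h2
  have hne := P.pow_toEnd_f_ne_zero_of_eq_nat hm (i := m - k) (by omega)
  refine (weightSpace_ne_bot_iff _).mpr ⟨_, ?_, hne⟩
  refine X_pow_mem_weightSpace C (negRoot α) (m - k) (X_pow_mem_weightSpace C α k hu rfl) ?_
  rw [hz, root_negRoot, Nat.cast_sub (by omega)]
  module

/-- The set of weights of a finite-dimensional module is stable under reflections. -/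
lemma weightSpace_reflection_ne_bot [FiniteDimensional ℂ F] (C : ChevalleyBasis H)
    (α : H.root) {χ χ' : Module.Dual ℂ H}
    (hχ' : χ - χ ((rootSystem H).coroot α) • (rootSystem H).root α = χ')
    (h : LieModule.weightSpace F (χ : H → ℂ) ≠ ⊥) :
    LieModule.weightSpace F (χ' : H → ℂ) ≠ ⊥ := by
  subst hχ'
  rcases le_total 0 (χ ((rootSystem H).coroot α)).re with h0 | h0
  · exact weightSpace_reflection_ne_bot_of_re_nonneg C α h0 h
  · have := weightSpace_reflection_ne_bot_of_re_nonneg C (negRoot α) (χ := χ)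
      (by rw [coroot_negRoot, map_neg, Complex.neg_re]; linarith) h
    rwa [coroot_negRoot, root_negRoot, map_neg, neg_smul, smul_neg, neg_neg] at this

end

/-! ### Monomials in the negative root vectors and their rational span. -/

section

variable {L : Type*} [LieRing L] [LieAlgebra ℂ L] [FiniteDimensional ℂ L] [IsSemisimple ℂ L]
  {H : LieSubalgebra ℂ L} [H.IsCartanSubalgebra]
variable {F : Type*} [AddCommGroup F] [Module ℂ F] [LieRingModule L F] [LieModule ℂ L F]

/-- The products of root vectors `Y α`, for `α` positive, applied to the vector `v` of weight `μ`,
together with their weights. -/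
inductive IsYMonomial (C : ChevalleyBasis H) (b : (rootSystem H).Base) (μ : Module.Dual ℂ H)
    (v : F) : Module.Dual ℂ H → F → Prop
  | base : IsYMonomial C b μ v μ v
  | step {χ : Module.Dual ℂ H} {m : F} (α : H.root) (hα : b.IsPos α)
      (hm : IsYMonomial C b μ v χ m) :
      IsYMonomial C b μ v (χ - (rootSystem H).root α) ⁅C.Y α, m⁆

lemma IsIntegralWeight.sub_zsmul {χ : Module.Dual ℂ H} (hχ : IsIntegralWeight χ) (n : ℤ)
    (α : H.root) : IsIntegralWeight (χ - (n : ℂ) • (rootSystem H).root α) := fun β => by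
  obtain ⟨p, hp⟩ := hχ β
  obtain ⟨q, hq⟩ := exists_int_root_coroot α β
  refine ⟨p - n * q, ?_⟩
  rw [LinearMap.sub_apply, LinearMap.smul_apply, hp, hq]
  push_cast
  rfl

/-- A highest weight is dominant. -/
lemma IsHighestWeightVector.exists_nat [FiniteDimensional ℂ F] (C : ChevalleyBasis H)
    {b : (rootSystem H).Base} {μ : Module.Dual ℂ H} {v : F} (hv : IsHighestWeightVector b μ v)
    {α : H.root} (hα : b.IsPos α) : ∃ n : ℕ, μ ((rootSystem H).coroot α) = n := by
  have P : (C.isSl2Triple α).HasPrimitiveVectorWith v (μ ((rootSystem H).coroot α)) :=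
    ⟨hv.ne_zero, (mem_weightSpace_iff _ _).mp hv.mem_weightSpace _,
      hv.lie_eq_zero α hα _ (C.X_mem α)⟩
  exact P.exists_nat

lemma IsHighestWeightVector.isIntegralWeight [FiniteDimensional ℂ F] (C : ChevalleyBasis H)
    {b : (rootSystem H).Base} {μ : Module.Dual ℂ H} {v : F} (hv : IsHighestWeightVector b μ v) :
    IsIntegralWeight μ := by
  intro α
  rcases isPos_or_isPos_negRoot b α with h | h
  · obtain ⟨n, hn⟩ := hv.exists_nat C h
    exact ⟨n, by simpa using hn⟩
  · obtain ⟨n, hn⟩ := hv.exists_nat C h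
    refine ⟨-n, ?_⟩
    rw [coroot_negRoot, map_neg] at hn
    push_cast
    rw [← hn, neg_neg]

section Monomial

variable {C : ChevalleyBasis H} {b : (rootSystem H).Base} {μ χ : Module.Dual ℂ H} {v m : F}

lemma IsYMonomial.mem_weightSpace (hm : IsYMonomial C b μ v χ m)
    (hv : v ∈ LieModule.weightSpace F (μ : H → ℂ)) :
    m ∈ LieModule.weightSpace F (χ : H → ℂ) := by
  induction hm with
  | base => exact hv
  | step α hα _ ih =>
    exact X_lie_mem_weightSpace C (negRoot α) ih (by rw [root_negRoot, sub_eq_add_neg])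

lemma IsYMonomial.isIntegralWeight (hm : IsYMonomial C b μ v χ m) (hμ : IsIntegralWeight μ) :
    IsIntegralWeight χ := by
  induction hm with
  | base => exact hμ
  | step α hα _ ih => simpa using ih.sub_zsmul 1 α

/-- Grading by height: every factor `Y α` lowers the eigenvalue of `ρ` by a positive integer, so `v`
is the only monomial of top degree. -/
lemma IsYMonomial.eq_or_exists (hm : IsYMonomial C b μ v χ m) {ρ : H}
    (hρ : ∀ α : H.root, (rootSystem H).root α ρ = b.height α) :
    m = v ∧ χ = μ ∨ ∃ d : ℕ, 0 < d ∧ χ ρ = μ ρ - d := by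
  induction hm with
  | base => exact Or.inl ⟨rfl, rfl⟩
  | @step χ m α hα _ ih =>
    right
    have hα' : 0 < b.height α := hα
    have hcast : ((b.height α).toNat : ℂ) = b.height α := by
      exact_mod_cast Int.toNat_of_nonneg hα'.le
    rcases ih with ⟨-, rfl⟩ | ⟨d, hd, h⟩
    · refine ⟨(b.height α).toNat, by omega, ?_⟩
      rw [LinearMap.sub_apply, hρ, hcast]
    · refine ⟨d + (b.height α).toNat, by omega, ?_⟩
      rw [LinearMap.sub_apply, hρ, h, Nat.cast_add, hcast]
      ring

variable (C b μ v) in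
/-- The rational span of the monomials in the `Y α` applied to `v`. -/
def rationalForm [Module ℚ F] : Submodule ℚ F :=
  Submodule.span ℚ {m | ∃ χ, IsYMonomial C b μ v χ m}

lemma IsYMonomial.mem_rationalForm [Module ℚ F] (hm : IsYMonomial C b μ v χ m) :
    m ∈ rationalForm C b μ v :=
  Submodule.subset_span ⟨χ, hm⟩

lemma lie_qsmul [Module ℚ F] (x : L) (q : ℚ) (u : F) : ⁅x, q • u⁆ = q • ⁅x, u⁆ := by
  rw [← Rat.cast_smul_eq_qsmul ℂ, lie_smul, Rat.cast_smul_eq_qsmul]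

lemma lie_mem_rationalForm_of_forall [Module ℚ F] {x : L}
    (hx : ∀ χ m, IsYMonomial C b μ v χ m → ⁅x, m⁆ ∈ rationalForm C b μ v) {u : F}
    (hu : u ∈ rationalForm C b μ v) : ⁅x, u⁆ ∈ rationalForm C b μ v := by
  induction hu using Submodule.span_induction with
  | mem u hu => exact hx _ _ hu.choose_spec
  | zero => simp
  | add u w _ _ hu hw => rw [lie_add]; exact add_mem hu hw
  | smul q u _ hu => rw [lie_qsmul]; exact Submodule.smul_mem _ q hu

lemma Y_lie_mem_rationalForm [Module ℚ F] {α : H.root} (hα : b.IsPos α) {u : F}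
    (hu : u ∈ rationalForm C b μ v) : ⁅C.Y α, u⁆ ∈ rationalForm C b μ v :=
  lie_mem_rationalForm_of_forall (fun _ _ hm => (hm.step α hα).mem_rationalForm) hu

variable [FiniteDimensional ℂ F]

/-- Commute `X α` past the leading `Y β`. The commutator is a coroot, acting by an integer, or a
rational multiple of another root vector, or zero. The second case is why the induction runs over
all roots at once. -/
lemma IsYMonomial.X_lie_mem_rationalForm [Module ℚ F] (hv : IsHighestWeightVector b μ v)
    (hm : IsYMonomial C b μ v χ m) (α : H.root) : ⁅C.X α, m⁆ ∈ rationalForm C b μ v := by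
  induction hm generalizing α with
  | base =>
    rcases isPos_or_isPos_negRoot b α with h | h
    · rw [hv.lie_eq_zero α h _ (C.X_mem α)]
      exact zero_mem _
    · have := (IsYMonomial.base (C := C) (b := b) (μ := μ) (v := v)).step _ h
      rw [ChevalleyBasis.Y, ChevalleyBasis.negRoot_negRoot] at this
      exact this.mem_rationalForm
  | @step χ m β hβ hm ih =>
    rw [leibniz_lie]
    refine add_mem ?_ (Y_lie_mem_rationalForm hβ (ih α))
    rw [ChevalleyBasis.Y]
    rcases C.lie_X_X_cases α (negRoot β) with h | ⟨γ, q, h⟩ | h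
    · rw [h, C.lie_X_neg α]
      have h1 := (mem_weightSpace_iff _ _).mp (hm.mem_weightSpace hv.mem_weightSpace)
        ((rootSystem H).coroot α)
      obtain ⟨n, hn⟩ := hm.isIntegralWeight (hv.isIntegralWeight C) α
      rw [rootSystem_coroot_apply] at h1 hn
      rw [h1, hn, Int.cast_smul_eq_zsmul]
      exact zsmul_mem hm.mem_rationalForm n
    · rw [h, smul_lie, Rat.cast_smul_eq_qsmul]
      exact Submodule.smul_mem _ q (ih γ)
    · rw [h, zero_lie]
      exact zero_mem _

lemma X_lie_mem_rationalForm [Module ℚ F] (hv : IsHighestWeightVector b μ v) (α : H.root) {u : F}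
    (hu : u ∈ rationalForm C b μ v) : ⁅C.X α, u⁆ ∈ rationalForm C b μ v :=
  lie_mem_rationalForm_of_forall (fun _ _ hm => hm.X_lie_mem_rationalForm hv α) hu

lemma X_pow_mem_rationalForm [Module ℚ F] (hv : IsHighestWeightVector b μ v) (α : H.root) {u : F}
    (hu : u ∈ rationalForm C b μ v) (n : ℕ) :
    (LieModule.toEnd ℂ L F (C.X α) ^ n) u ∈ rationalForm C b μ v := by
  induction n with
  | zero => simpa using hu
  | succ n ih =>
    rw [pow_succ', Module.End.mul_apply]
    exact X_lie_mem_rationalForm hv α ih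

variable (C) in
/-- An irreducible module is spanned by the monomials applied to a highest weight vector. -/
lemma span_isYMonomial_eq_top [Module ℚ F] [LieModule.IsIrreducible ℂ L F]
    (hv : IsHighestWeightVector b μ v) :
    Submodule.span ℂ {m : F | ∃ χ, IsYMonomial C b μ v χ m} = ⊤ := by
  set N := Submodule.span ℂ {m : F | ∃ χ, IsYMonomial C b μ v χ m}
  have hle : ∀ u ∈ rationalForm C b μ v, u ∈ N := fun u hu => by
    induction hu using Submodule.span_induction with
    | mem u hu => exact Submodule.subset_span hu
    | zero => exact zero_mem _
    | add u w _ _ hu hw => exact add_mem hu hw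
    | smul q u _ hu => rw [← Rat.cast_smul_eq_qsmul ℂ]; exact Submodule.smul_mem _ _ hu
  have hgen (x : L) (hx : ∀ χ m, IsYMonomial C b μ v χ m → ⁅x, m⁆ ∈ N) (u : F) (hu : u ∈ N) :
      ⁅x, u⁆ ∈ N := by
    induction hu using Submodule.span_induction with
    | mem u hu => exact hx _ _ hu.choose_spec
    | zero => simp
    | add u w _ _ hu hw => rw [lie_add]; exact add_mem hu hw
    | smul q u _ hu => rw [lie_smul]; exact Submodule.smul_mem _ q hu
  -- The elements of `L` that preserve `N`; they contain `H` and all root vectors, hence everything.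
  let p : Submodule ℂ L :=
    { carrier := {x | ∀ u ∈ N, ⁅x, u⁆ ∈ N}
      add_mem' := fun {x y} hx hy u hu => by rw [add_lie]; exact add_mem (hx u hu) (hy u hu)
      zero_mem' := fun u _ => by simp
      smul_mem' := fun c x hx u hu => by rw [smul_lie]; exact N.smul_mem c (hx u hu) }
  have hp : ∀ x : L, x ∈ p := by
    refine C.mem_of_forall_X_mem p (fun h => hgen _ fun χ m hm => ?_)
      (fun α => hgen _ fun χ m hm => hle _ (hm.X_lie_mem_rationalForm hv α))
    rw [(mem_weightSpace_iff _ _).mp (hm.mem_weightSpace hv.mem_weightSpace) h]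
    exact N.smul_mem _ (Submodule.subset_span ⟨χ, hm⟩)
  let N' : LieSubmodule ℂ L F := { N with lie_mem := fun {x u} hu => hp x u hu }
  have hN' : N' ≠ ⊥ := fun h => hv.ne_zero <| by
    have : v ∈ N' := Submodule.subset_span ⟨μ, IsYMonomial.base⟩
    rwa [h, LieSubmodule.mem_bot] at this
  have htop : N' = ⊤ := (eq_bot_or_eq_top N').resolve_left hN'
  exact (LieSubmodule.toSubmodule_eq_top (N := N')).mpr htop

/-! ### The top of the weight diagram. -/

section Weights

variable [Module ℚ F] [LieModule.IsIrreducible ℂ L F]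

/-- The weights lying above the highest weight do not occur. -/
lemma weightSpace_add_root_eq_bot (C : ChevalleyBasis H) (hv : IsHighestWeightVector b μ v) {α : H.root}
    (hα : b.IsPos α) :
    LieModule.weightSpace F ((μ + (rootSystem H).root α : Module.Dual ℂ H) : H → ℂ) = ⊥ := by
  obtain ⟨ρ, hρ⟩ := exists_root_apply_eq_height b
  by_contra hne
  obtain ⟨u, hu, hu0⟩ := (weightSpace_ne_bot_iff _).mp hne
  apply hu0
  set T := LieModule.toEnd ℂ L F (ρ : L)
  have hα' : 0 < b.height α := hα
  -- Monomials have `ρ`-eigenvalues `μ ρ - d` with `d ≥ 0`, never the larger `μ ρ + b.height α`;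
  -- independence of eigenspaces then kills `u`.
  have hle : (⊤ : Submodule ℂ F) ≤ ⨆ j, ⨆ (_ : j ≠ μ ρ + b.height α), T.eigenspace j := by
    rw [← span_isYMonomial_eq_top C hv, Submodule.span_le]
    rintro m ⟨χ, hm⟩
    have hmem : m ∈ T.eigenspace (χ ρ) := by
      rw [Module.End.mem_eigenspace_iff]
      exact (mem_weightSpace_iff _ _).mp (hm.mem_weightSpace hv.mem_weightSpace) ρ
    refine Submodule.mem_iSup_of_mem (χ ρ) (Submodule.mem_iSup_of_mem ?_ hmem)
    rcases hm.eq_or_exists hρ with ⟨-, rfl⟩ | ⟨d, hd, h⟩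
    · intro h
      have : (b.height α : ℂ) = 0 := by linear_combination -h
      have : b.height α = 0 := by exact_mod_cast this
      omega
    · rw [h]
      intro h'
      have : (b.height α + d : ℂ) = 0 := by linear_combination -h'
      have : b.height α + d = 0 := by exact_mod_cast this
      omega
  have hmem : u ∈ T.eigenspace (μ ρ + b.height α) := by
    rw [Module.End.mem_eigenspace_iff, ← hρ]
    exact (mem_weightSpace_iff _ _).mp hu ρ
  exact Submodule.disjoint_def.mp (T.eigenspaces_iSupIndep (μ ρ + b.height α)) u hmem
    (hle Submodule.mem_top)

/-- Every monomial other than `v` has a `ρ`-eigenvalue different from `μ ρ`, so modulo `v` nothing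
of weight `μ` is left. -/
lemma exists_smul_eq_of_mem_weightSpace (C : ChevalleyBasis H) (hv : IsHighestWeightVector b μ v) {u : F}
    (hu : u ∈ LieModule.weightSpace F (μ : H → ℂ)) : ∃ c : ℂ, u = c • v := by
  obtain ⟨ρ, hρ⟩ := exists_root_apply_eq_height b
  set T := LieModule.toEnd ℂ L F (ρ : L)
  have hle : (⊤ : Submodule ℂ F) ≤
      Submodule.span ℂ {v} ⊔ ⨆ j, ⨆ (_ : j ≠ μ ρ), T.eigenspace j := by
    rw [← span_isYMonomial_eq_top C hv, Submodule.span_le]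
    rintro m ⟨χ, hm⟩
    rcases hm.eq_or_exists hρ with ⟨rfl, -⟩ | ⟨d, hd, h⟩
    · exact Submodule.mem_sup_left (Submodule.mem_span_singleton_self m)
    · have hmem : m ∈ T.eigenspace (χ ρ) := by
        rw [Module.End.mem_eigenspace_iff]
        exact (mem_weightSpace_iff _ _).mp (hm.mem_weightSpace hv.mem_weightSpace) ρ
      refine Submodule.mem_sup_right
        (Submodule.mem_iSup_of_mem (χ ρ) (Submodule.mem_iSup_of_mem ?_ hmem))
      rw [h]
      intro h'
      have : (d : ℂ) = 0 := by linear_combination -h'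
      have : d = 0 := by exact_mod_cast this
      omega
  obtain ⟨y, hy, z, hz, hyz⟩ := Submodule.mem_sup.mp (hle (Submodule.mem_top (x := u)))
  obtain ⟨c, rfl⟩ := Submodule.mem_span_singleton.mp hy
  refine ⟨c, ?_⟩
  have hz' : z = u - c • v := by rw [← hyz]; abel
  have hmem : z ∈ T.eigenspace (μ ρ) := by
    rw [Module.End.mem_eigenspace_iff, hz']
    exact (mem_weightSpace_iff _ _).mp (sub_mem hu
      (SMulMemClass.smul_mem c hv.mem_weightSpace)) ρ
  rw [← hyz, Submodule.disjoint_def.mp (T.eigenspaces_iSupIndep (μ ρ)) z hmem hz, add_zero]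

end Weights

/-! ### Rationality of the contravariant form. -/

section Form

variable [Module ℚ F] {B : LinearMap.BilinForm ℂ F}

lemma IsContravariant.X_lie_left (hB : IsContravariant C B) (α : H.root) (x y : F) :
    B ⁅C.X α, x⁆ y = B x ⁅C.X (negRoot α), y⁆ := by
  rw [hB.lie_left, C.sigma_X]

lemma IsContravariant.X_pow_left (hB : IsContravariant C B) (α : H.root) (n : ℕ) (x y : F) :
    B ((LieModule.toEnd ℂ L F (C.X α) ^ n) x) y =
      B x ((LieModule.toEnd ℂ L F (C.X (negRoot α)) ^ n) y) := by
  induction n generalizing y with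
  | zero => simp
  | succ n ih =>
    rw [pow_succ', Module.End.mul_apply, LieModule.toEnd_apply_apply, hB.X_lie_left, ih, pow_succ,
      Module.End.mul_apply, LieModule.toEnd_apply_apply]

lemma IsContravariant.Y_lie_left (hB : IsContravariant C B) (α : H.root) (x y : F) :
    B ⁅C.Y α, x⁆ y = B x ⁅C.X α, y⁆ := by
  rw [ChevalleyBasis.Y, hB.X_lie_left, ChevalleyBasis.negRoot_negRoot]

/-- The contravariant form is rational on the rational form. -/
lemma IsContravariant.exists_rat (hB : IsContravariant C B) (hv : IsHighestWeightVector b μ v)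
    (hBv : B v v = 1) {x y : F} (hx : x ∈ rationalForm C b μ v) (hy : y ∈ rationalForm C b μ v) :
    ∃ q : ℚ, B x y = q := by
  have hadd {p q : ℂ} (hp : ∃ r : ℚ, p = r) (hq : ∃ r : ℚ, q = r) : ∃ r : ℚ, p + q = r := by
    obtain ⟨r, rfl⟩ := hp
    obtain ⟨s, rfl⟩ := hq
    exact ⟨r + s, by push_cast; rfl⟩
  have hmul {p : ℂ} (a : ℚ) (hp : ∃ r : ℚ, p = r) : ∃ r : ℚ, (a : ℂ) * p = r := by
    obtain ⟨r, rfl⟩ := hp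
    exact ⟨a * r, by push_cast; rfl⟩
  have hbase : ∀ y ∈ rationalForm C b μ v, ∃ q : ℚ, B v y = q := by
    intro y hy
    induction hy using Submodule.span_induction with
    | mem y hy =>
      obtain ⟨χ, hm⟩ := hy
      cases hm with
      | base => exact ⟨1, by simpa using hBv⟩
      | step α hα hm =>
        exact ⟨0, by rw [hB.isSymm, hB.Y_lie_left, hv.lie_eq_zero α hα _ (C.X_mem α)]; simp⟩
    | zero => exact ⟨0, by simp⟩
    | add u w _ _ hu hw => rw [map_add]; exact hadd hu hw
    | smul q u _ hu =>
      rw [← Rat.cast_smul_eq_qsmul ℂ, map_smul, smul_eq_mul]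
      exact hmul q hu
  induction hx using Submodule.span_induction with
  | mem x hx =>
    obtain ⟨χ, hm⟩ := hx
    induction hm generalizing y with
    | base => exact hbase y hy
    -- Each `Y α` on the left crosses to the right as `X α`, which preserves the rational form,
    -- until only `v` remains on the left.
    | step α hα hm ih =>
      rw [hB.Y_lie_left]
      exact ih (X_lie_mem_rationalForm hv α hy)
  | zero => exact ⟨0, by simp⟩
  | add u w _ _ hu hw => rw [map_add, LinearMap.add_apply]; exact hadd hu hw
  | smul q u _ hu =>
    rw [← Rat.cast_smul_eq_qsmul ℂ, map_smul, LinearMap.smul_apply, smul_eq_mul]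
    exact hmul q hu

end Form

end Monomial

end

/-! ### Extremal weights and the induction over the Weyl group. -/

section

variable {L : Type*} [LieRing L] [LieAlgebra ℂ L] [FiniteDimensional ℂ L] [IsSemisimple ℂ L]
  {H : LieSubalgebra ℂ L} [H.IsCartanSubalgebra]
variable {F : Type*} [AddCommGroup F] [Module ℂ F] [LieRingModule L F] [LieModule ℂ L F]
  [Module ℚ F]

/-- The properties of a weight in the Weyl group orbit of the highest weight `μ`: its weight space
is the line through a vector of the rational form of positive square, and adding to it a root on
which it is nonnegative does not give a weight. -/
structure IsExtremalWeight (C : ChevalleyBasis H) (b : (rootSystem H).Base)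
    (μ : Module.Dual ℂ H) (v : F) (B : LinearMap.BilinForm ℂ F) (χ : Module.Dual ℂ H) : Prop where
  isIntegralWeight : IsIntegralWeight χ
  weightSpace_add_root_eq_bot (α : H.root) (n : ℕ) (hn : χ ((rootSystem H).coroot α) = n) :
    LieModule.weightSpace F ((χ + (rootSystem H).root α : Module.Dual ℂ H) : H → ℂ) = ⊥
  exists_vector : ∃ u ∈ rationalForm C b μ v, u ∈ LieModule.weightSpace F (χ : H → ℂ) ∧
    (∃ d : ℝ, 0 < d ∧ B u u = d) ∧
    ∀ x ∈ LieModule.weightSpace F (χ : H → ℂ), ∃ c : ℂ, x = c • u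

variable [FiniteDimensional ℂ F] [LieModule.IsIrreducible ℂ L F]
variable {C : ChevalleyBasis H} {b : (rootSystem H).Base} {μ χ : Module.Dual ℂ H} {v : F}
  {B : LinearMap.BilinForm ℂ F}

lemma isExtremalWeight_highestWeight (hv : IsHighestWeightVector b μ v) (hBv : B v v = 1) :
    IsExtremalWeight C b μ v B μ where
  isIntegralWeight := hv.isIntegralWeight C
  weightSpace_add_root_eq_bot α n hn := by
    rcases isPos_or_isPos_negRoot b α with h | h
    · exact weightSpace_add_root_eq_bot C hv h
    · obtain ⟨k, hk⟩ := hv.exists_nat C h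
      rw [coroot_negRoot, map_neg, hn] at hk
      have hnk : n + k = 0 := by
        have : (n : ℂ) + k = 0 := by rw [← hk]; ring
        exact_mod_cast this
      have hn0 : n = 0 := by omega
      by_contra hne
      -- Here `-α` is positive and `μ(α^∨) = 0`, so `s_α` sends `μ + α` to `μ - α`, which lies above
      -- the highest weight.
      refine weightSpace_reflection_ne_bot C α ?_ hne (weightSpace_add_root_eq_bot C hv h)
      rw [LinearMap.add_apply, root_coroot_self, hn, hn0, root_negRoot]
      push_cast
      module
  exists_vector := ⟨v, IsYMonomial.base.mem_rationalForm, hv.mem_weightSpace,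
    ⟨1, one_pos, by simpa using hBv⟩, fun _ hx => exists_smul_eq_of_mem_weightSpace C hv hx⟩

/-- The new weight is `s_α χ` and the new vector is `fⁿ u`, whose square length is a positive
multiple of that of `u`. The weight condition at `β` is transported by `s_α` from the condition at
`s_α β`. -/
lemma IsExtremalWeight.sub_smul (h : IsExtremalWeight C b μ v B χ)
    (hv : IsHighestWeightVector b μ v) (hB : IsContravariant C B) (α : H.root) (n : ℕ)
    (hn : χ ((rootSystem H).coroot α) = n) :
    IsExtremalWeight C b μ v B (χ - (n : ℂ) • (rootSystem H).root α) where
  isIntegralWeight := by simpa using h.isIntegralWeight.sub_zsmul n α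
  weightSpace_add_root_eq_bot β k hk := by
    by_contra hne
    set γ := (rootSystem H).reflectionPerm α β
    have hroot : (rootSystem H).root γ = (rootSystem H).root β -
        (rootSystem H).root β ((rootSystem H).coroot α) • (rootSystem H).root α := by
      rw [RootPairing.root_reflectionPerm, RootPairing.reflection_apply]
      simp
    have hcoroot : (rootSystem H).coroot γ = (rootSystem H).coroot β -
        (rootSystem H).root α ((rootSystem H).coroot β) • (rootSystem H).coroot α := by
      rw [RootPairing.coroot_reflectionPerm, RootPairing.coreflection_apply]
      simp
    refine weightSpace_reflection_ne_bot C α ?_ hne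
      (h.weightSpace_add_root_eq_bot γ k ?_)
    · rw [hroot, LinearMap.add_apply, LinearMap.sub_apply, LinearMap.smul_apply, root_coroot_self,
        hn, smul_eq_mul]
      module
    · rw [hcoroot, map_sub, map_smul, hn, ← hk, LinearMap.sub_apply, LinearMap.smul_apply,
        smul_eq_mul, smul_eq_mul, mul_comm]
  exists_vector := by
    obtain ⟨u, huS, hu, ⟨d, hd, hBu⟩, hspan⟩ := h.exists_vector
    have hu0 : u ≠ 0 := by
      rintro rfl
      have : d = 0 := by
        have : (d : ℂ) = 0 := by rw [← hBu]; simp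
        exact_mod_cast this
      exact hd.ne' this
    have t := C.isSl2Triple α
    have hbot := h.weightSpace_add_root_eq_bot α n hn
    have P : t.HasPrimitiveVectorWith u (n : ℂ) := by
      refine ⟨hu0, by rw [(mem_weightSpace_iff _ _).mp hu, hn], ?_⟩
      have := X_lie_mem_weightSpace C α hu rfl
      rwa [hbot, LieSubmodule.mem_bot] at this
    obtain ⟨c, hc, hcu⟩ := exists_pow_toEnd_pow_toEnd P n le_rfl
    refine ⟨_, X_pow_mem_rationalForm hv (negRoot α) huS n,
      X_pow_mem_weightSpace C (negRoot α) n hu ?_, ⟨c * d, by positivity, ?_⟩, fun x hx => ?_⟩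
    · rw [root_negRoot]
      module
    · rw [hB.X_pow_left, ChevalleyBasis.negRoot_negRoot, hcu, map_smul, hBu, smul_eq_mul]
      push_cast
      rfl
    · by_cases hx0 : x = 0
      · exact ⟨0, by simp [hx0]⟩
      -- The same argument from below: `f` kills `x`, because `χ - (n + 1) α` reflects to the
      -- non-weight `χ + α`. Thus `x` is proportional to `fⁿ eⁿ x`, and `eⁿ x` is a multiple of `u`.
      have P' : t.symm.HasPrimitiveVectorWith x (n : ℂ) := by
        refine ⟨hx0, ?_, ?_⟩
        · rw [neg_lie, (mem_weightSpace_iff _ _).mp hx, LinearMap.sub_apply, LinearMap.smul_apply,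
            root_coroot_self, hn, ← neg_smul]
          congr 1
          simp only [smul_eq_mul]
          ring
        · by_contra hne
          have hmem := X_lie_mem_weightSpace C (negRoot α) hx rfl
          refine weightSpace_reflection_ne_bot C α ?_
            ((weightSpace_ne_bot_iff _).mpr ⟨_, hmem, hne⟩) hbot
          rw [root_negRoot, LinearMap.add_apply, LinearMap.sub_apply, LinearMap.smul_apply,
            LinearMap.neg_apply, root_coroot_self, hn, smul_eq_mul]
          module
      obtain ⟨c', hc', hcx⟩ := exists_pow_toEnd_pow_toEnd P' n le_rfl
      obtain ⟨a, ha⟩ := hspan _ (X_pow_mem_weightSpace C α (χ' := χ) n hx (by module))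
      have hc0 : (c' : ℂ) ≠ 0 := by exact_mod_cast hc'.ne'
      refine ⟨(c' : ℂ)⁻¹ * a, ?_⟩
      rw [mul_smul, ← map_smul, ← ha, hcx, inv_smul_smul₀ hc0]

lemma IsExtremalWeight.reflection (h : IsExtremalWeight C b μ v B χ)
    (hv : IsHighestWeightVector b μ v) (hB : IsContravariant C B) (α : H.root) :
    IsExtremalWeight C b μ v B ((rootSystem H).reflection α χ) := by
  have heq : (rootSystem H).reflection α χ =
      χ - χ ((rootSystem H).coroot α) • (rootSystem H).root α := by
    rw [RootPairing.reflection_apply]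
    simp
  rw [heq]
  obtain ⟨z, hz⟩ := h.isIntegralWeight α
  rw [hz]
  obtain ⟨n, rfl | rfl⟩ := z.eq_nat_or_neg
  · simpa using h.sub_smul hv hB α n (by simpa using hz)
  -- The roots `α` and `-α` define the same reflection, and the pairing with `-α` is nonnegative.
  · have := h.sub_smul hv hB (negRoot α) n (by rw [coroot_negRoot, map_neg, hz]; simp)
    rw [root_negRoot] at this
    simpa using this

lemma IsExtremalWeight.weylGroup_smul (h : IsExtremalWeight C b μ v B χ)
    (hv : IsHighestWeightVector b μ v) (hB : IsContravariant C B) (w : (rootSystem H).weylGroup) :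
    IsExtremalWeight C b μ v B (w • χ) := by
  obtain ⟨w, hw⟩ := w
  induction hw using RootPairing.weylGroup.induction generalizing χ with
  | mem i => exact h.reflection hv hB i
  | one => simpa using h
  | mul x y hx hy hx' hy' =>
    rw [← Submonoid.mk_mul_mk _ x y hx hy, mul_smul]
    exact hx' (hy' h)

end

/-! ### The lattice generated by divided powers. -/

section

variable {L : Type*} [LieRing L] [LieAlgebra ℂ L] [FiniteDimensional ℂ L] [IsSemisimple ℂ L]
  {H : LieSubalgebra ℂ L} [H.IsCartanSubalgebra]
variable {F : Type*} [AddCommGroup F] [Module ℂ F] [LieRingModule L F] [LieModule ℂ L F]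
variable {C : ChevalleyBasis H} {b : (rootSystem H).Base} {μ χ : Module.Dual ℂ H} {v : F}

/-- The products of divided powers of the `Y α`, for `α` positive, applied to the vector `v`,
together with the total height of the roots used. -/
inductive IsDividedMonomial (C : ChevalleyBasis H) (b : (rootSystem H).Base) (v : F) :
    ℕ → F → Prop
  | base : IsDividedMonomial C b v 0 v
  | step {d : ℕ} {m : F} (α : H.root) (hα : b.IsPos α) (n : ℕ) (hn : 0 < n)
      (hm : IsDividedMonomial C b v d m) :
      IsDividedMonomial C b v (d + n * (b.height α).toNat)
        ((n.factorial : ℂ)⁻¹ • (LieModule.toEnd ℂ L F (C.Y α) ^ n) m)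


lemma IsDividedMonomial.exists_mem_weightSpace {d : ℕ} {m : F} (hm : IsDividedMonomial C b v d m)
    (hv : v ∈ LieModule.weightSpace F (μ : H → ℂ)) {ρ : H}
    (hρ : ∀ α : H.root, (rootSystem H).root α ρ = b.height α) :
    ∃ χ : Module.Dual ℂ H, m ∈ LieModule.weightSpace F (χ : H → ℂ) ∧ χ ρ = μ ρ - d := by
  induction hm with
  | base => exact ⟨μ, hv, by simp⟩
  | @step d m α hα n hn _ ih =>
    obtain ⟨χ, hχ, h⟩ := ih
    refine ⟨χ + (n : ℂ) • (rootSystem H).root (negRoot α),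
      SMulMemClass.smul_mem _ (X_pow_mem_weightSpace C (negRoot α) n hχ rfl), ?_⟩
    have hα' : 0 < b.height α := hα
    have hcast : ((b.height α).toNat : ℂ) = b.height α := by
      exact_mod_cast Int.toNat_of_nonneg hα'.le
    rw [root_negRoot, LinearMap.add_apply, LinearMap.smul_apply, LinearMap.neg_apply, hρ, h]
    push_cast
    rw [hcast, smul_eq_mul]
    ring

/-- Positive exponents and heights make the degree grow strictly at each step, so a last factor has
exponent at most `d` and acts on a monomial of degree below `d`. -/
lemma finite_setOf_isDividedMonomial (C : ChevalleyBasis H) (b : (rootSystem H).Base) (v : F)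
    (d : ℕ) : {m | IsDividedMonomial C b v d m}.Finite := by
  induction d using Nat.strong_induction_on with
  | _ d ih =>
    have hfin : ({v} ∪ ⋃ (α : H.root), ⋃ n ∈ Set.Iic d, ⋃ d' ∈ Set.Iio d,
        (fun m : F => (n.factorial : ℂ)⁻¹ • (LieModule.toEnd ℂ L F (C.Y α) ^ n) m) ''
          {m | IsDividedMonomial C b v d' m}).Finite := by
      refine (Set.finite_singleton v).union (Set.finite_iUnion fun α => ?_)
      refine (Set.finite_Iic d).biUnion fun n _ => (Set.finite_Iio d).biUnion fun d' hd' => ?_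
      exact (ih d' hd').image _
    refine hfin.subset fun m hm => ?_
    cases hm with
    | base => exact Or.inl rfl
    | @step d' m α hα n hn hm =>
      have hα' : 0 < (b.height α).toNat := by
        have : 0 < b.height α := hα
        omega
      right
      simp only [Set.mem_iUnion]
      exact ⟨α, n, by simp only [Set.mem_Iic]; nlinarith, d',
        by simp only [Set.mem_Iio]; nlinarith, m, hm, rfl⟩

/-- Bounds the lattice from above, both by the rational form and by the span of the divided
monomials. -/
lemma lift_mem_of_mem_kostantNegative (p : AddSubgroup F)
    (hp : ∀ (α : H.root) (n : ℕ), b.IsPos α → ∀ x ∈ p,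
      (n.factorial : ℂ)⁻¹ • (LieModule.toEnd ℂ L F (C.Y α) ^ n) x ∈ p)
    {u : UniversalEnvelopingAlgebra ℂ L} (hu : u ∈ C.kostantNegative b) {x : F} (hx : x ∈ p) :
    UniversalEnvelopingAlgebra.lift ℂ (LieModule.toEnd ℂ L F) u x ∈ p := by
  induction hu using Algebra.adjoin_induction generalizing x with
  | mem u hu =>
    obtain ⟨α, n, hα, rfl⟩ := hu
    rw [map_smul, map_pow, UniversalEnvelopingAlgebra.lift_ι_apply]
    exact hp α n hα x hx
  | algebraMap z =>
    rw [eq_intCast, map_intCast]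
    have := p.zsmul_mem hx z
    rwa [← Int.cast_smul_eq_zsmul (Module.End ℂ F)] at this
  | add u u' _ _ h h' =>
    rw [map_add, LinearMap.add_apply]
    exact p.add_mem (h hx) (h' hx)
  | mul u u' _ _ h h' =>
    rw [map_mul, Module.End.mul_apply]
    exact h (h' hx)

lemma Y_lie_mem_integralForm {α : H.root} (hα : b.IsPos α) {x : F}
    (hx : x ∈ integralForm C b v) : ⁅C.Y α, x⁆ ∈ integralForm C b v := by
  rw [mem_integralForm] at hx ⊢
  obtain ⟨u, hu, rfl⟩ := hx
  refine ⟨UniversalEnvelopingAlgebra.ι ℂ (C.Y α) * u, mul_mem (Algebra.subset_adjoin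
    ⟨α, 1, hα, by simp⟩) hu, ?_⟩
  rw [map_mul, UniversalEnvelopingAlgebra.lift_ι_apply]
  rfl

lemma mem_integralForm_self : v ∈ integralForm C b v :=
  (mem_integralForm C b v v).mpr ⟨1, one_mem _, by simp⟩

lemma IsYMonomial.mem_integralForm {m : F} (hm : IsYMonomial C b μ v χ m) :
    m ∈ integralForm C b v := by
  induction hm with
  | base => exact mem_integralForm_self
  | step α hα _ ih => exact Y_lie_mem_integralForm hα ih

/-- The monomials themselves lie in the lattice, so clearing denominators suffices. -/
lemma exists_smul_mem_integralForm [Module ℚ F] {x : F} (hx : x ∈ rationalForm C b μ v) :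
    ∃ N : ℕ, 0 < N ∧ N • x ∈ integralForm C b v := by
  induction hx using Submodule.span_induction with
  | mem x hx => exact ⟨1, one_pos, by simpa using hx.choose_spec.mem_integralForm⟩
  | zero => exact ⟨1, one_pos, by simp⟩
  | add x y _ _ hx hy =>
    obtain ⟨M, hM, hx⟩ := hx
    obtain ⟨N, hN, hy⟩ := hy
    refine ⟨M * N, by positivity, ?_⟩
    rw [smul_add]
    refine add_mem ?_ ?_
    · rw [mul_comm, mul_smul]
      exact nsmul_mem hx N
    · rw [mul_smul]
      exact nsmul_mem hy M
  | smul q x _ hx =>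
    obtain ⟨N, hN, hx⟩ := hx
    refine ⟨N * q.den, by have := q.den_pos; positivity, ?_⟩
    have : (N * q.den) • q • x = q.num • N • x := by
      simp only [← Nat.cast_smul_eq_nsmul ℚ, ← Int.cast_smul_eq_zsmul ℚ, smul_smul]
      congr 1
      push_cast
      rw [mul_assoc, mul_comm (q.den : ℚ), Rat.mul_den_eq_num, mul_comm]
    rw [this]
    exact zsmul_mem hx _

variable [FiniteDimensional ℂ F]

lemma integralForm_le_rationalForm [Module ℚ F] (hv : IsHighestWeightVector b μ v) {x : F}
    (hx : x ∈ integralForm C b v) : x ∈ rationalForm C b μ v := by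
  obtain ⟨u, hu, rfl⟩ := (mem_integralForm C b v x).mp hx
  refine lift_mem_of_mem_kostantNegative (rationalForm C b μ v).toAddSubgroup
    (fun α n hα x hx => ?_) hu (IsYMonomial.base.mem_rationalForm : v ∈ rationalForm C b μ v)
  have h := Submodule.smul_mem _ (n.factorial : ℚ)⁻¹ (X_pow_mem_rationalForm hv (negRoot α) hx n)
  rw [← Rat.cast_smul_eq_qsmul ℂ] at h
  push_cast at h
  exact h

/-- The lattice generated by a highest weight vector is finitely generated. -/
lemma fg_integralForm (C : ChevalleyBasis H) (hv : IsHighestWeightVector b μ v) :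
    (integralForm C b v).FG := by
  classical
  obtain ⟨ρ, hρ⟩ := exists_root_apply_eq_height b
  set T := LieModule.toEnd ℂ L F (ρ : L)
  -- A nonzero monomial of degree `d` is an eigenvector of `ρ` for `μ ρ - d`, so only finitely many
  -- degrees contribute.
  have hfin : {d : ℕ | T.HasEigenvalue (μ ρ - d)}.Finite := by
    refine Set.Finite.of_finite_image (f := fun d : ℕ => μ ρ - d)
      ((Module.End.finite_hasEigenvalue T).subset ?_) (fun a _ c _ h => by simpa using h)
    rintro _ ⟨d, hd, rfl⟩
    exact hd
  set A : Set F := ⋃ d ∈ {d : ℕ | T.HasEigenvalue (μ ρ - d)}, {m | IsDividedMonomial C b v d m}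
  have hA : A.Finite := hfin.biUnion fun d _ => finite_setOf_isDividedMonomial C b v d
  have hmem {d : ℕ} {m : F} (hm : IsDividedMonomial C b v d m) : m ∈ Submodule.span ℤ A := by
    by_cases hm0 : m = 0
    · rw [hm0]
      exact zero_mem _
    obtain ⟨χ, hχ, h⟩ := hm.exists_mem_weightSpace hv.mem_weightSpace hρ
    refine Submodule.subset_span (Set.mem_biUnion (x := d) ?_ hm)
    refine Module.End.hasEigenvalue_of_hasEigenvector (x := m) ⟨?_, hm0⟩
    rw [Module.End.mem_eigenspace_iff, ← h]
    exact (mem_weightSpace_iff _ _).mp hχ ρ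
  have hstable (α : H.root) (n : ℕ) (hα : b.IsPos α) (x : F) (hx : x ∈ Submodule.span ℤ A) :
      (n.factorial : ℂ)⁻¹ • (LieModule.toEnd ℂ L F (C.Y α) ^ n) x ∈ Submodule.span ℤ A := by
    induction hx using Submodule.span_induction with
    | mem x hx =>
      obtain ⟨d, -, hd⟩ := Set.mem_iUnion₂.mp hx
      rcases n.eq_zero_or_pos with rfl | hn
      · simpa using hmem hd
      · exact hmem (IsDividedMonomial.step α hα n hn hd)
    | zero => simp
    | add x y _ _ hx hy => rw [map_add, smul_add]; exact add_mem hx hy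
    | smul z x _ hx => rw [map_zsmul, smul_comm]; exact zsmul_mem hx z
  have hle : integralForm C b v ≤ Submodule.span ℤ A := by
    intro x hx
    obtain ⟨u, hu, rfl⟩ := (mem_integralForm C b v x).mp hx
    exact lift_mem_of_mem_kostantNegative (Submodule.span ℤ A).toAddSubgroup hstable hu
      (hmem IsDividedMonomial.base)
  have hfg : (Submodule.span ℤ A).FG := ⟨hA.toFinset, by simp⟩
  have : IsNoetherian ℤ (Submodule.span ℤ A) := isNoetherian_of_fg_of_noetherian _ hfg
  exact Submodule.FG.of_le hfg hle

end

/-- A nonzero finitely generated subgroup of a rational line is free of rank one. -/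
lemma nonempty_basis_fin_one {F : Type*} [AddCommGroup F] [Module ℚ F] (Λ : Submodule ℤ F)
    (hfg : Λ.FG) (u : F) (hu : ∀ x ∈ Λ, ∃ q : ℚ, x = q • u) (hΛ : ∃ x ∈ Λ, x ≠ 0) :
    Nonempty (Module.Basis (Fin 1) ℤ Λ) := by
  have : Module.Finite ℤ Λ := Module.Finite.iff_fg.mpr hfg
  have : IsAddTorsionFree F := IsAddTorsionFree.of_module_rat F
  have : Module.Free ℤ Λ := Module.free_of_finite_type_torsion_free'
  let e := Module.finBasis ℤ Λ
  suffices h : Module.finrank ℤ Λ = 1 from ⟨e.reindex (finCongr h)⟩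
  have hpos : 0 < Module.finrank ℤ Λ := by
    rw [Nat.pos_iff_ne_zero]
    intro h
    have : IsEmpty (Fin (Module.finrank ℤ Λ)) := by rw [h]; infer_instance
    obtain ⟨x, hx, hx0⟩ := hΛ
    have hs : (⟨x, hx⟩ : Λ) = 0 := e.ext_elem fun i => isEmptyElim i
    exact hx0 (congrArg Subtype.val hs)
  by_contra hne
  have h2 : 1 < Module.finrank ℤ Λ := by omega
  let i : Fin (Module.finrank ℤ Λ) := ⟨0, hpos⟩
  let j : Fin (Module.finrank ℤ Λ) := ⟨1, h2⟩
  have hij : i ≠ j := by simp [i, j, Fin.ext_iff]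
  obtain ⟨p, hp⟩ := hu _ (e i).2
  obtain ⟨q, hq⟩ := hu _ (e j).2
  -- Cross-multiplying `e i = p u` and `e j = q u` gives an integral relation; independence then
  -- forces `q = 0`, hence `e j = 0`.
  have hrel : (q.num * p.den) • e i + (-(p.num * q.den)) • e j = 0 := by
    apply Subtype.ext
    simp only [Submodule.coe_add, Submodule.coe_smul, Submodule.coe_zero]
    rw [hp, hq, ← Int.cast_smul_eq_zsmul ℚ, ← Int.cast_smul_eq_zsmul ℚ, smul_smul, smul_smul,
      ← add_smul]
    have : ((q.num * p.den : ℤ) : ℚ) * p + ((-(p.num * q.den) : ℤ) : ℚ) * q = 0 := by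
      push_cast
      rw [← Rat.mul_den_eq_num p, ← Rat.mul_den_eq_num q]
      ring
    rw [this, zero_smul]
  have hli : LinearIndependent ℤ ![e i, e j] := by
    have hinj : Function.Injective ![i, j] := by
      intro x y h
      fin_cases x <;> fin_cases y <;> simp_all
    convert! e.linearIndependent.comp ![i, j] hinj using 1
    ext x : 1
    fin_cases x <;> rfl
  have hq0 : q.num = 0 := by
    have := (LinearIndependent.pair_iff.mp hli _ _ hrel).1
    have hp0 : (p.den : ℤ) ≠ 0 := by exact_mod_cast p.den_nz
    exact (mul_eq_zero.mp this).resolve_right hp0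
  refine e.ne_zero j (Subtype.ext ?_)
  rw [hq, Rat.num_eq_zero.mp hq0, zero_smul]
  rfl

/-- The Gram determinant of a bilinear form on a lattice of rank one does not depend on the
basis. -/
lemma det_gram_eq_of_basis_fin_one {F : Type*} [AddCommGroup F] [Module ℂ F]
    (B : LinearMap.BilinForm ℂ F) (Λ : Submodule ℤ F) (g : Module.Basis (Fin 1) ℤ Λ) (n : ℕ)
    (e : Module.Basis (Fin n) ℤ Λ) :
    (Matrix.of fun i j : Fin n => B (e i : F) (e j : F)).det = B (g 0 : F) (g 0 : F) := by
  obtain rfl : n = 1 := by simpa using Fintype.card_congr (e.indexEquiv g)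
  rw [Matrix.det_fin_one, Matrix.of_apply]
  have h1 : e 0 = g.repr (e 0) 0 • g 0 := by simpa using (g.sum_repr (e 0)).symm
  have h2 : g 0 = e.repr (g 0) 0 • e 0 := by simpa using (e.sum_repr (g 0)).symm
  set a := g.repr (e 0) 0
  set c := e.repr (g 0) 0
  -- The change of basis is a unit `±1` of `ℤ`, and it enters the form squared.
  have hca : (c * a) • g 0 = (1 : ℤ) • g 0 := by
    rw [mul_smul, ← h1, ← h2, one_smul]
  have hca' : c * a = 1 := by
    have := congrArg (fun x => g.repr x 0) hca
    simpa using this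
  have haa : a * a = 1 := by
    rcases Int.isUnit_iff.mp (IsUnit.of_mul_eq_one_right c hca') with h | h <;> simp [h]
  have h3 : (e 0 : F) = (a : ℂ) • (g 0 : F) := by
    rw [Int.cast_smul_eq_zsmul]
    exact congrArg Subtype.val h1
  rw [h3]
  simp only [map_smul, LinearMap.smul_apply, smul_eq_mul]
  rw [← mul_assoc]
  have : (a : ℂ) * a = 1 := by exact_mod_cast haa
  rw [this, one_mul]

end

end SignedKL

open SignedKL LieAlgebra LieAlgebra.IsKilling in
theorem lemma4p6p2
    {L : Type*} [LieRing L] [LieAlgebra ℂ L] [FiniteDimensional ℂ L] [IsSemisimple ℂ L]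
    {H : LieSubalgebra ℂ L} [H.IsCartanSubalgebra]
    (b : (rootSystem H).Base) (C : ChevalleyBasis H)
    (ν : Module.Dual ℂ H) (hν : IsIntegralWeight ν)
    {F : Type*} [AddCommGroup F] [Module ℂ F] [LieRingModule L F] [LieModule ℂ L F]
    [FiniteDimensional ℂ F] [LieModule.IsIrreducible ℂ L F]
    (μ : Module.Dual ℂ H) (v₀ : F) (hv₀ : IsHighestWeightVector b μ v₀)
    (hμν : μ ∈ MulAction.orbit (rootSystem H).weylGroup ν)
    (B : LinearMap.BilinForm ℂ F) (hB : IsContravariant C B) (hBv₀ : B v₀ v₀ = 1)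
    (w : (rootSystem H).weylGroup) :
    Module.finrank ℂ (LieModule.weightSpace F ((w • ν : Module.Dual ℂ H) : H → ℂ)) = 1 ∧
    Nonempty (Module.Basis (Fin 1) ℤ (integralWeightSpace C b v₀ (w • ν))) ∧
    ∃ d : ℝ, 0 < d ∧
      ∀ (n : ℕ) (e : Module.Basis (Fin n) ℤ (integralWeightSpace C b v₀ (w • ν))),
        (Matrix.of fun i j : Fin n => B (e i : F) (e j : F)).det = (d : ℂ) := by
  let _ : Module ℚ F := Module.compHom F (algebraMap ℚ ℂ)
  obtain ⟨w', rfl⟩ := hμν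
  have hext : IsExtremalWeight C b (w' • ν) v₀ B (w • ν) := by
    -- The highest weight is `w' • ν`, so `w * w'⁻¹` carries it to `w • ν`.
    have := (isExtremalWeight_highestWeight (C := C) hv₀ hBv₀).weylGroup_smul hv₀ hB (w * w'⁻¹)
    rwa [mul_smul, inv_smul_smul] at this
  obtain ⟨u, huS, hu, ⟨r, hr, hBu⟩, hspan⟩ := hext.exists_vector
  have hr0 : (r : ℂ) ≠ 0 := by exact_mod_cast hr.ne'
  have hu0 : u ≠ 0 := by
    rintro rfl
    exact hr0 (by rw [← hBu]; simp)
  set Λ := integralWeightSpace C b v₀ (w • ν)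
  have hΛ (x : F) (hx : x ∈ Λ) : ∃ q : ℚ, x = q • u := by
    obtain ⟨c, rfl⟩ := hspan x hx.2
    obtain ⟨p, hp⟩ := hB.exists_rat hv₀ hBv₀ (integralForm_le_rationalForm hv₀ hx.1) huS
    obtain ⟨s, hs⟩ := hB.exists_rat hv₀ hBv₀ huS huS
    have hs0 : (s : ℂ) ≠ 0 := by rwa [← hs, hBu]
    -- With `x = c u`, the coefficient is `c = B x u / B u u`, a quotient of rationals.
    refine ⟨p / s, ?_⟩
    rw [← Rat.cast_smul_eq_qsmul ℂ]
    congr 1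
    rw [map_smul, LinearMap.smul_apply, smul_eq_mul, hs] at hp
    push_cast
    rw [← hp, mul_div_cancel_right₀ _ hs0]
  obtain ⟨N, hN, hNu⟩ := exists_smul_mem_integralForm huS
  have hne : ∃ x ∈ Λ, x ≠ 0 :=
    ⟨N • u, ⟨hNu, nsmul_mem hu N⟩, by
      rw [← Nat.cast_smul_eq_nsmul ℂ]
      exact smul_ne_zero (by exact_mod_cast hN.ne') hu0⟩
  have hfg : Λ.FG := by
    have : IsNoetherian ℤ (integralForm C b v₀) :=
      isNoetherian_of_fg_of_noetherian _ (fg_integralForm C hv₀)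
    exact Submodule.FG.of_le (fg_integralForm C hv₀) inf_le_left
  obtain ⟨g⟩ := nonempty_basis_fin_one Λ hfg u hΛ hne
  refine ⟨?_, ⟨g⟩, ?_⟩
  · refine finrank_eq_one (⟨u, hu⟩ : LieModule.weightSpace F _)
      (fun h => hu0 (congrArg Subtype.val h)) fun x => ?_
    obtain ⟨c, hc⟩ := hspan x x.2
    exact ⟨c, Subtype.ext hc.symm⟩
  · obtain ⟨q, hq⟩ := hΛ _ (g 0).2
    have hq0 : q ≠ 0 := by
      rintro rfl
      exact g.ne_zero 0 (Subtype.ext (by rw [hq, zero_smul]; rfl))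
    have hq0' : (q : ℝ) ≠ 0 := by exact_mod_cast hq0
    -- The generator is `q u`, of square length `q² r`; rationality of `q` is what makes `q²`
    -- positive.
    refine ⟨q * q * r, mul_pos (mul_self_pos.mpr hq0') hr, fun n e => ?_⟩
    rw [det_gram_eq_of_basis_fin_one B Λ g n e, hq, ← Rat.cast_smul_eq_qsmul ℂ]
    simp only [map_smul, LinearMap.smul_apply, smul_eq_mul, hBu]
    push_cast
    ring
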